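/- Write $[\omega]^\omega$ for the set of infinite subsets of $\omega$. Let $\mathfrak{a}$ be the least size of an infinite maximal almost disjoint family, i.e. of an infinite family $\mathcal{A}\subseteq[\omega]^\omega$ whose distinct members have finite intersection and such that every $X\in[\omega]^\omega$ has infinite intersection with some $A\in\mathcal{A}$. Let $\mathfrak{s}$ be the least size of a splitting family, i.e. of a family $\mathcal{S}\subseteq[\omega]^\omega$ such that for every $X\in[\omega]^\omega$ there is $A\in\mathcal{S}$ with $X\cap A$ and $X\setminus A$ both infinite. Let $\mathfrak{b}$ be the least size of a family $\mathcal{F}\subseteq\omega^\omega$ such that for every $g\in\omega^\omega$ there is $f\in\mathcal{F}$ with $f(m)>g(m)$ for infinitely many $m$. For $2\le n<\omega$, an infinite family $\mathcal{X}\subseteq([\omega]^\omega)^n$ is called $n$-ad if for any two distinct members $(X^0,\dots,X^{n-1})$ and $(Y^0,\dots,Y^{n-1})$ of $\mathcal{X}$ there is $i<n$ such that $X^i\cap Y^i$ is finite; it is called $n$-mad if it is maximal under inclusion among $n$-ad families. Let $\mathfrak{a}(n)$ be the least size of an $n$-mad family, and put $\mathfrak{a}(1):=\mathfrak{a}$.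 Then: 1. $\omega_1\le\mathfrak{a}(n+1)\le\mathfrak{a}(n)\le\mathfrak{a}$ for all $1\le n<\omega$. 2. $\min\{\mathfrak{s},\mathfrak{a}(n-1)\}\le\mathfrak{a}(n)$ for all $2\le n<\omega$. 3. $\mathfrak{b}\le\mathfrak{a}(2)$. -/

import Mathlib

open scoped Cardinal

noncomputable section

/-- `F` is an infinite maximal almost disjoint family of infinite subsets of `ℕ`. -/
def IsMadFamily (F : Set (Set ℕ)) : Prop :=
  F.Infinite ∧ (∀ A ∈ F, A.Infinite) ∧
    (∀ A ∈ F, ∀ B ∈ F, A ≠ B → (A ∩ B).Finite) ∧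
    ∀ X : Set ℕ, X.Infinite → ∃ A ∈ F, (X ∩ A).Infinite

/-- The almost disjointness number `𝔞`. -/
def madNumber : Cardinal.{0} :=
  sInf {κ | ∃ F : Set (Set ℕ), IsMadFamily F ∧ #F = κ}

/-- `F` is a splitting family of infinite subsets of `ℕ`. -/
def IsSplittingFamily (F : Set (Set ℕ)) : Prop :=
  (∀ A ∈ F, A.Infinite) ∧
    ∀ X : Set ℕ, X.Infinite → ∃ A ∈ F, (X ∩ A).Infinite ∧ (X \ A).Infinite

/-- The splitting number `𝔰`. -/
def splittingNumber : Cardinal.{0} :=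
  sInf {κ | ∃ F : Set (Set ℕ), IsSplittingFamily F ∧ #F = κ}

/-- `F` is unbounded in `ℕ → ℕ` for eventual domination. -/
def IsUnboundedFamily (F : Set (ℕ → ℕ)) : Prop :=
  ∀ g : ℕ → ℕ, ∃ f ∈ F, {m : ℕ | g m < f m}.Infinite

/-- The bounding number `𝔟`. -/
def boundingNumber : Cardinal.{0} :=
  sInf {κ | ∃ F : Set (ℕ → ℕ), IsUnboundedFamily F ∧ #F = κ}

/-- `F` is an `n`-ad family: an infinite set of `n`-tuples of infinite subsets of `ℕ` such that
any two distinct members are almost disjoint in at least one coordinate. -/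
def IsNAdFamily (n : ℕ) (F : Set (Fin n → Set ℕ)) : Prop :=
  F.Infinite ∧ (∀ X ∈ F, ∀ i, (X i).Infinite) ∧
    ∀ X ∈ F, ∀ Y ∈ F, X ≠ Y → ∃ i, (X i ∩ Y i).Finite

/-- `F` is an `n`-mad family: an `n`-ad family that is maximal under inclusion. -/
def IsNMadFamily (n : ℕ) (F : Set (Fin n → Set ℕ)) : Prop :=
  Maximal (IsNAdFamily n) F

/-- The number `𝔞(n)`: by convention `𝔞(1) = 𝔞`, and for `n ≥ 2` it is the least size of an
`n`-mad family. (The value at `n = 0` has no meaning.) -/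
def nMadNumber (n : ℕ) : Cardinal.{0} :=
  if n = 1 then madNumber
  else sInf {κ | ∃ F : Set (Fin n → Set ℕ), IsNMadFamily n F ∧ #F = κ}

end

/-! An `n`-ad family is maximal exactly when every tuple of infinite sets meets some member
infinitely in every coordinate. Adding a coordinate constantly equal to `ℕ` preserves this, so
𝔞(n+1) ≤ 𝔞(n).

The lower bounds rest on `false_of_dense_decides`. Suppose an (m+1)-mad family F is smaller than
𝔞(m) and 𝔞, and that below every infinite set, in every coordinate, there is an infinite set Z not
split by F: each member's coordinate almost contains Z or almost misses it. Unsplit sets turn "meets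
infinitely" into "almost contains", and two members almost containing the same Z in one coordinate
must be almost disjoint in another. A nonprincipal ultrafilter on F then yields unsplit sets Y in
the last m coordinates that infinitely many members almost contain. The first coordinates of these
members form an almost disjoint family of size below 𝔞, so some infinite set is almost disjoint from
all of them; together with Y it contradicts maximality.

If |F| < 𝔰, unsplit sets exist below every infinite set, which gives min{𝔰, 𝔞(n-1)} ≤ 𝔞(n); with ω₁
≤ 𝔰 and ω₁ ≤ 𝔟 ≤ 𝔞, induction gives ω₁ ≤ 𝔞(n). If n = 2 and |F| < 𝔟, a failure of density produces
infinitely many members almost containing one set D in the same coordinate, and the classical proof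
of 𝔟 ≤ 𝔞 applies to the other coordinate. -/

/-! ### Maximality criterion, existence, and monotonicity of 𝔞(n) -/

/-- Every tuple of infinite sets has infinite intersection, in all coordinates, with some member. -/
def MeetsAll (n : ℕ) (F : Set (Fin n → Set ℕ)) : Prop :=
  ∀ W : Fin n → Set ℕ, (∀ i, (W i).Infinite) → ∃ X ∈ F, ∀ i, (X i ∩ W i).Infinite

/-- A tuple that meets no member in all coordinates could be added to the family; conversely, a
tuple that meets a member in all coordinates can only be added if it equals that member. -/
theorem isNMadFamily_iff {n : ℕ} {F : Set (Fin n → Set ℕ)} :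
    IsNMadFamily n F ↔ IsNAdFamily n F ∧ MeetsAll n F := by
  constructor
  · rintro ⟨hF, hmax⟩
    refine ⟨hF, fun W hW => ?_⟩
    by_contra hcon
    push Not at hcon
    have hins : IsNAdFamily n (insert W F) := by
      refine ⟨hF.1.mono (Set.subset_insert _ _), ?_, ?_⟩
      · rintro X (rfl | hX)
        · exact hW
        · exact hF.2.1 X hX
      · rintro X (rfl | hX) Y (rfl | hY) hne
        · exact absurd rfl hne
        · obtain ⟨i, hi⟩ := hcon Y hY
          exact ⟨i, by rwa [Set.inter_comm]⟩
        · exact hcon X hX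
        · exact hF.2.2 X hX Y hY hne
    have hWF : W ∈ F := hmax hins (Set.subset_insert _ _) (Set.mem_insert _ _)
    obtain ⟨i, hi⟩ := hcon W hWF
    rw [Set.inter_self] at hi
    exact hW i hi
  · rintro ⟨hF, hM⟩
    refine ⟨hF, fun G hG hFG Y hY => ?_⟩
    obtain ⟨X, hX, hXY⟩ := hM Y (hG.2.1 Y hY)
    by_cases h : X = Y
    · exact h ▸ hX
    · obtain ⟨i, hi⟩ := hG.2.2 X (hFG hX) Y hY h
      exact absurd hi (hXY i)

/-- Zorn's lemma above the infinite disjoint family of columns of the pairing function. Existence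
matters because the infimum of an empty set of cardinals is 0, so it would not be attained. -/
theorem exists_isMadFamily : ∃ F : Set (Set ℕ), IsMadFamily F := by
  let S : Set (Set (Set ℕ)) := {F | (∀ A ∈ F, A.Infinite) ∧
    ∀ A ∈ F, ∀ B ∈ F, A ≠ B → (A ∩ B).Finite}
  let col : ℕ → Set ℕ := fun k => Set.range fun j => Nat.pair k j
  have hcol : ∀ k, (col k).Infinite := fun k =>
    Set.infinite_range_of_injective fun a b h => (Nat.pair_eq_pair.1 h).2
  have hdisj : ∀ k l, k ≠ l → col k ∩ col l = ∅ := by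
    intro k l hkl
    ext x
    simp only [Set.mem_inter_iff, Set.mem_empty_iff_false, iff_false]
    rintro ⟨⟨a, rfl⟩, ⟨b, hb⟩⟩
    exact hkl (Nat.pair_eq_pair.1 hb).1.symm
  have hinj : Function.Injective col := by
    intro k l h
    by_contra hkl
    have h1 := hdisj k l hkl
    rw [h, Set.inter_self] at h1
    exact (hcol l) (h1 ▸ Set.finite_empty)
  have h0 : Set.range col ∈ S := by
    refine ⟨?_, ?_⟩
    · rintro _ ⟨k, rfl⟩
      exact hcol k
    · rintro _ ⟨k, rfl⟩ _ ⟨l, rfl⟩ hne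
      rw [hdisj k l fun h => hne (h ▸ rfl)]
      exact Set.finite_empty
  obtain ⟨F, hsub, hF, hmax⟩ := zorn_subset_nonempty S (by
    intro c hc hchain _
    refine ⟨⋃₀ c, ⟨?_, ?_⟩, fun s hs => Set.subset_sUnion_of_mem hs⟩
    · rintro A ⟨s, hs, hA⟩
      exact (hc hs).1 A hA
    · rintro A ⟨s, hs, hA⟩ B ⟨t, ht, hB⟩ hne
      rcases hchain.total hs ht with h | h
      · exact (hc ht).2 A (h hA) B hB hne
      · exact (hc hs).2 A hA B (h hB) hne) _ h0
  refine ⟨F, (Set.infinite_range_of_injective hinj).mono hsub, hF.1, hF.2, fun X hX => ?_⟩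
  by_contra hcon
  have hfin : ∀ A ∈ F, (X ∩ A).Finite := fun A hA => by
    by_contra h
    exact hcon ⟨A, hA, h⟩
  have hins : insert X F ∈ S := by
    refine ⟨?_, ?_⟩
    · rintro A (rfl | hA)
      · exact hX
      · exact hF.1 A hA
    · rintro A (rfl | hA) B (rfl | hB) hne
      · exact absurd rfl hne
      · exact hfin B hB
      · rw [Set.inter_comm]
        exact hfin A hA
      · exact hF.2 A hA B hB hne
  have hXF : X ∈ F := hmax hins (Set.subset_insert _ _) (Set.mem_insert _ _)
  have := hfin X hXF
  rw [Set.inter_self] at this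
  exact hX this

/-- A mad family, regarded as a family of `1`-tuples. -/
theorem IsMadFamily.image_const {F : Set (Set ℕ)} (hF : IsMadFamily F) :
    IsNAdFamily 1 ((fun A (_ : Fin 1) => A) '' F) ∧ MeetsAll 1 ((fun A (_ : Fin 1) => A) '' F) := by
  have hinj : Function.Injective (fun (A : Set ℕ) (_ : Fin 1) => A) :=
    fun A B h => congrFun h 0
  refine ⟨⟨hF.1.image hinj.injOn, ?_, ?_⟩, fun W hW => ?_⟩
  · rintro _ ⟨A, hA, rfl⟩ i
    exact hF.2.1 A hA
  · rintro _ ⟨A, hA, rfl⟩ _ ⟨B, hB, rfl⟩ hne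
    exact ⟨0, hF.2.2.1 A hA B hB fun h => hne (h ▸ rfl)⟩
  · obtain ⟨A, hA, h⟩ := hF.2.2.2 (W 0) (hW 0)
    refine ⟨_, ⟨A, hA, rfl⟩, fun i => ?_⟩
    rw [Set.inter_comm, Subsingleton.elim i 0]
    exact h

theorem isMadFamily_image_eval {F : Set (Fin 1 → Set ℕ)} (hF : IsNAdFamily 1 F)
    (hM : MeetsAll 1 F) : IsMadFamily ((fun X => X 0) '' F) := by
  have hinj : Function.Injective (fun X : Fin 1 → Set ℕ => X 0) := fun X Y h => by
    funext i
    rw [Subsingleton.elim i 0]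
    exact h
  refine ⟨hF.1.image hinj.injOn, ?_, ?_, fun W hW => ?_⟩
  · rintro _ ⟨X, hX, rfl⟩
    exact hF.2.1 X hX 0
  · rintro _ ⟨X, hX, rfl⟩ _ ⟨Y, hY, rfl⟩ hne
    obtain ⟨i, hi⟩ := hF.2.2 X hX Y hY fun h => hne (h ▸ rfl)
    rw [Subsingleton.elim i 0] at hi
    exact hi
  · obtain ⟨X, hX, h⟩ := hM (fun _ => W) fun _ => hW
    exact ⟨_, ⟨X, hX, rfl⟩, by rw [Set.inter_comm]; exact h 0⟩

/-- Adding a coordinate that is constantly `ℕ`. -/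
theorem isNAdFamily_image_cons_univ {n : ℕ} {F : Set (Fin n → Set ℕ)} (hF : IsNAdFamily n F)
    (hM : MeetsAll n F) :
    IsNAdFamily (n + 1) ((fun X => (Fin.cons Set.univ X : Fin (n + 1) → Set ℕ)) '' F) ∧
      MeetsAll (n + 1) ((fun X => (Fin.cons Set.univ X : Fin (n + 1) → Set ℕ)) '' F) := by
  have hinj : Function.Injective
      (fun X : Fin n → Set ℕ => (Fin.cons Set.univ X : Fin (n + 1) → Set ℕ)) :=
    fun X Y h => (Fin.cons_inj.1 h).2
  refine ⟨⟨hF.1.image hinj.injOn, ?_, ?_⟩, fun W hW => ?_⟩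
  · rintro _ ⟨X, hX, rfl⟩ i
    refine Fin.cases ?_ (fun i => ?_) i
    · simpa using Set.infinite_univ
    · simpa using hF.2.1 X hX i
  · rintro _ ⟨X, hX, rfl⟩ _ ⟨Y, hY, rfl⟩ hne
    obtain ⟨i, hi⟩ := hF.2.2 X hX Y hY fun h => hne (h ▸ rfl)
    exact ⟨i.succ, by simpa using hi⟩
  · obtain ⟨X, hX, h⟩ := hM (fun i => W i.succ) fun i => hW i.succ
    refine ⟨_, ⟨X, hX, rfl⟩, fun i => ?_⟩
    refine Fin.cases ?_ (fun i => ?_) i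
    · simpa using hW 0
    · simpa using h i

theorem exists_isNAdFamily_meetsAll {n : ℕ} (hn : 1 ≤ n) :
    ∃ F, IsNAdFamily n F ∧ MeetsAll n F := by
  induction n, hn using Nat.le_induction with
  | base =>
    obtain ⟨F, hF⟩ := exists_isMadFamily
    exact ⟨_, hF.image_const⟩
  | succ n hn ih =>
    obtain ⟨F, hF, hM⟩ := ih
    exact ⟨_, isNAdFamily_image_cons_univ hF hM⟩

theorem nMadNumber_le {n : ℕ} (hn : 1 ≤ n) {F : Set (Fin n → Set ℕ)} (hF : IsNAdFamily n F)
    (hM : MeetsAll n F) : nMadNumber n ≤ #F := by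
  unfold nMadNumber
  split_ifs with h
  · subst h
    exact (csInf_le' ⟨_, isMadFamily_image_eval hF hM, rfl⟩ : madNumber ≤ _).trans Cardinal.mk_image_le
  · exact csInf_le' ⟨F, isNMadFamily_iff.2 ⟨hF, hM⟩, rfl⟩

theorem exists_mk_eq_nMadNumber {n : ℕ} (hn : 1 ≤ n) :
    ∃ F : Set (Fin n → Set ℕ), IsNAdFamily n F ∧ MeetsAll n F ∧ #F = nMadNumber n := by
  by_cases h : n = 1
  · subst h
    obtain ⟨F, hF, hc⟩ : madNumber ∈ {κ | ∃ F : Set (Set ℕ), IsMadFamily F ∧ #F = κ} :=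
      csInf_mem (let ⟨F, hF⟩ := exists_isMadFamily; ⟨_, F, hF, rfl⟩)
    refine ⟨_, hF.image_const.1, hF.image_const.2, ?_⟩
    rw [Cardinal.mk_image_eq fun A B h => congrFun h 0, hc]
    simp [nMadNumber]
  · obtain ⟨F, hF, hc⟩ : nMadNumber n ∈
        {κ | ∃ F : Set (Fin n → Set ℕ), IsNMadFamily n F ∧ #F = κ} := by
      rw [nMadNumber, if_neg h]
      exact csInf_mem (let ⟨F, hF⟩ := exists_isNAdFamily_meetsAll hn
        ⟨_, F, isNMadFamily_iff.2 hF, rfl⟩)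
    obtain ⟨h1, h2⟩ := isNMadFamily_iff.1 hF
    exact ⟨F, h1, h2, hc⟩

theorem nMadNumber_one : nMadNumber 1 = madNumber := by simp [nMadNumber]

theorem nMadNumber_succ_le {n : ℕ} (hn : 1 ≤ n) : nMadNumber (n + 1) ≤ nMadNumber n := by
  obtain ⟨F, hF, hM, hc⟩ := exists_mk_eq_nMadNumber hn
  obtain ⟨h1, h2⟩ := isNAdFamily_image_cons_univ hF hM
  exact (nMadNumber_le (by omega) h1 h2).trans (Cardinal.mk_image_le.trans hc.le)

theorem nMadNumber_le_madNumber {n : ℕ} (hn : 1 ≤ n) : nMadNumber n ≤ madNumber := by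
  induction n, hn using Nat.le_induction with
  | base => exact nMadNumber_one.le
  | succ n hn ih => exact (nMadNumber_succ_le hn).trans ih

/-! ### Small families with densely many unsplit sets -/

/-- An infinite family of fewer than `𝔞(m)` tuples, almost disjoint on the coordinates listed by
`σ`, is not maximal on these coordinates. -/
theorem exists_avoiding {k m : ℕ} (hm : 1 ≤ m) (σ : Fin m → Fin k) {G : Set (Fin k → Set ℕ)}
    (hinf : G.Infinite) (hG : ∀ X ∈ G, ∀ i, (X i).Infinite)
    (hpair : ∀ X ∈ G, ∀ Y ∈ G, X ≠ Y → ∃ i, (X (σ i) ∩ Y (σ i)).Finite)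
    (hlt : #G < nMadNumber m) :
    ∃ W : Fin m → Set ℕ, (∀ i, (W i).Infinite) ∧ ∀ X ∈ G, ∃ i, (X (σ i) ∩ W i).Finite := by
  by_contra hcon
  push Not at hcon
  have hinj : Set.InjOn (fun (X : Fin k → Set ℕ) i => X (σ i)) G := by
    intro X hX Y hY h
    by_contra hne
    obtain ⟨i, hi⟩ := hpair X hX Y hY hne
    have h1 : X (σ i) = Y (σ i) := congrFun h i
    rw [← h1, Set.inter_self] at hi
    exact hG X hX _ hi
  refine absurd ((nMadNumber_le hm (F := (fun (X : Fin k → Set ℕ) i => X (σ i)) '' G)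
    ⟨hinf.image hinj, ?_, ?_⟩ ?_).trans Cardinal.mk_image_le) (not_le.2 hlt)
  · rintro _ ⟨X, hX, rfl⟩ i
    exact hG X hX _
  · rintro _ ⟨X, hX, rfl⟩ _ ⟨Y, hY, rfl⟩ hne
    exact hpair X hX Y hY fun h => hne (h ▸ rfl)
  · intro W hW
    obtain ⟨X, hX, h⟩ := hcon W hW
    exact ⟨_, ⟨X, hX, rfl⟩, h⟩

/-- `Z` is not split by the `i`-th coordinates of the members of `F`. -/
def Decides {n : ℕ} (F : Set (Fin n → Set ℕ)) (i : Fin n) (Z : Set ℕ) : Prop :=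
  ∀ X ∈ F, (Z \ X i).Finite ∨ (X i ∩ Z).Finite

theorem Set.Infinite.not_finite_diff_inter {Z A : Set ℕ} (hZ : Z.Infinite)
    (h1 : (Z \ A).Finite) (h2 : (A ∩ Z).Finite) : False :=
  hZ ((h1.union h2).subset fun z hz => by
    by_cases h : z ∈ A
    · exact Or.inr ⟨h, hz⟩
    · exact Or.inl ⟨hz, h⟩)

theorem Set.Infinite.inter_infinite_of_diff_finite {Z A B : Set ℕ} (hZ : Z.Infinite)
    (hA : (Z \ A).Finite) (hB : (Z \ B).Finite) : (A ∩ B).Infinite := fun h =>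
  hZ (((hA.union hB).union h).subset fun z hz => by
    by_cases h1 : z ∈ A
    · by_cases h2 : z ∈ B
      · exact Or.inr ⟨h1, h2⟩
      · exact Or.inl (Or.inr ⟨hz, h2⟩)
    · exact Or.inl (Or.inl ⟨hz, h1⟩))

/-- If every infinite set contains, for each coordinate, an infinite set that is not split by `F`,
then `F` is not a small maximal family. -/
theorem false_of_dense_decides {m : ℕ} (hm : 1 ≤ m) {F : Set (Fin (m + 1) → Set ℕ)}
    (hF : IsNAdFamily (m + 1) F) (hM : MeetsAll (m + 1) F)
    (hlt : #F < nMadNumber m) (hlt1 : #F < nMadNumber 1)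
    (hdec : ∀ i, ∀ C : Set ℕ, C.Infinite → ∃ Z ⊆ C, Z.Infinite ∧ Decides F i Z) : False := by
  -- Members of `P Z` share almost all of `Z` in coordinate 0, so they are almost disjoint in their
  -- tails. If `Z` is unsplit, testing maximality on `Z` followed by `W` shows that these tails meet
  -- every `W`.
  let P : Set ℕ → Set (Fin (m + 1) → Set ℕ) := fun Z => {X ∈ F | (Z \ X 0).Finite}
  have hPF : ∀ Z, P Z ⊆ F := fun Z X hX => hX.1
  have hPpair : ∀ Z, Z.Infinite → ∀ X ∈ P Z, ∀ Y ∈ P Z, X ≠ Y →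
      ∃ i : Fin m, (X i.succ ∩ Y i.succ).Finite := by
    intro Z hZ X hX Y hY hne
    obtain ⟨i, hi⟩ := hF.2.2 X hX.1 Y hY.1 hne
    rcases Fin.eq_zero_or_eq_succ i with rfl | ⟨j, rfl⟩
    · exact absurd hi (hZ.inter_infinite_of_diff_finite hX.2 hY.2)
    · exact ⟨j, hi⟩
  have hPmeet : ∀ Z, Z.Infinite → Decides F 0 Z → ∀ W : Fin m → Set ℕ, (∀ i, (W i).Infinite) →
      ∃ X ∈ P Z, ∀ i : Fin m, (X i.succ ∩ W i).Infinite := by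
    intro Z hZ hd W hW
    obtain ⟨X, hX, h⟩ := hM (Fin.cons Z W) (fun i => by
      refine Fin.cases ?_ (fun i => ?_) i
      · simpa using hZ
      · simpa using hW i)
    refine ⟨X, ⟨hX, (hd X hX).resolve_right ?_⟩, fun i => ?_⟩
    · simpa using h 0
    · simpa using h i.succ
  have hPfin : ∀ Z, Z.Infinite → Decides F 0 Z → (P Z).Finite := by
    intro Z hZ hd
    by_contra hinf
    obtain ⟨W, hW, h⟩ := exists_avoiding hm Fin.succ hinf (fun X hX => hF.2.1 X hX.1)
      (hPpair Z hZ) ((Cardinal.mk_le_mk_of_subset (hPF Z)).trans_lt hlt)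
    obtain ⟨X, hX, h'⟩ := hPmeet Z hZ hd W hW
    obtain ⟨i, hi⟩ := h X hX
    exact h' i hi
  have hex : ∀ X : F, ∃ Z ⊆ X.1 0, Z.Infinite ∧ Decides F 0 Z := fun X =>
    hdec 0 _ (hF.2.1 X.1 X.2 0)
  choose ζ hζsub hζinf hζdec using hex
  have : Infinite F := hF.1.to_subtype
  -- The limit of the families `P (ζ X)` along a nonprincipal ultrafilter on `F`. Any two of its
  -- members lie in a common `P (ζ X)`, so its tails are again almost disjoint.
  let L : Set (Fin (m + 1) → Set ℕ) :=
    {Y ∈ F | ∀ᶠ X in (Filter.hyperfilter F : Filter F), Y ∈ P (ζ X)}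
  have hLF : L ⊆ F := fun Y hY => hY.1
  have hLavoid : ∃ W : Fin m → Set ℕ, (∀ i, (W i).Infinite) ∧
      ∀ X ∈ L, ∃ i : Fin m, (X i.succ ∩ W i).Finite := by
    by_cases hLfin : L.Finite
    -- If `L` is finite, almost every `P (ζ X)` contains all of `L`, and also `X`. Were the tails of
    -- `L` to meet everything, the tail of `X` would meet that of a member of `L`, forcing `X` into
    -- `L`; but a finite `L` cannot contain almost every `X`.
    · by_contra hcon
      push Not at hcon
      have h1 : ∀ᶠ X in (Filter.hyperfilter F : Filter F), ∀ Y ∈ L, Y ∈ P (ζ X) :=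
        (Filter.eventually_all_finite hLfin).2 fun Y hY => hY.2
      have h2 : ∀ᶠ X in (Filter.hyperfilter F : Filter F), X.1 ∈ L := by
        filter_upwards [h1] with X hX
        have hXP : X.1 ∈ P (ζ X) := by
          refine ⟨X.2, ?_⟩
          rw [Set.sdiff_eq_empty.2 (hζsub X)]
          exact Set.finite_empty
        obtain ⟨Y, hY, h⟩ := hcon (fun i => X.1 i.succ) fun i => hF.2.1 X.1 X.2 _
        by_cases hne : Y = X.1
        · exact hne ▸ hY
        · obtain ⟨i, hi⟩ := hPpair _ (hζinf X) Y (hX Y hY) X.1 hXP hne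
          exact absurd hi (h i)
      have h3 : {X : F | X.1 ∈ L}.Finite := hLfin.preimage Subtype.val_injective.injOn
      exact Filter.notMem_hyperfilter_of_finite h3 h2
    · refine exists_avoiding hm Fin.succ hLfin (fun X hX => hF.2.1 X hX.1) ?_
        ((Cardinal.mk_le_mk_of_subset hLF).trans_lt hlt)
      intro X hX Y hY hne
      obtain ⟨V, h1, h2⟩ := (hX.2.and hY.2).exists
      exact hPpair _ (hζinf V) X h1 Y h2 hne
  obtain ⟨W, hW, hWL⟩ := hLavoid
  choose Y hYW hYinf hYdec using fun i : Fin m => hdec i.succ (W i) (hW i)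
  let V : Set (Fin (m + 1) → Set ℕ) := {X ∈ F | ∀ i : Fin m, (Y i \ X i.succ).Finite}
  have hVmem : ∀ X ∈ F, (∀ i : Fin m, (X i.succ ∩ Y i).Infinite) → X ∈ V := fun X hX h =>
    ⟨hX, fun i => (hYdec i X hX).resolve_right (h i)⟩
  -- Every `P (ζ X)` meets `V`. If `V` were finite, the ultrafilter would select one `x` in `V`
  -- lying in almost every `P (ζ X)`, that is in `L`; but `W` avoids the tail of `x` in some
  -- coordinate, where `x` almost contains `Y i ⊆ W i`.
  have hVinf : V.Infinite := by
    intro hVfin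
    have h1 : ∀ᶠ X in (Filter.hyperfilter F : Filter F), ∃ x ∈ V, x ∈ P (ζ X) :=
      Filter.Eventually.of_forall fun X => by
        obtain ⟨x, hx, h⟩ := hPmeet _ (hζinf X) (hζdec X) Y hYinf
        exact ⟨x, hVmem x hx.1 h, hx⟩
    have h2 : ∃ x ∈ V, ∀ᶠ X in (Filter.hyperfilter F : Filter F), x ∈ P (ζ X) := by
      have h3 : (⋃ x ∈ V, {X : F | x ∈ P (ζ X)}) ∈ Filter.hyperfilter F := by
        filter_upwards [h1] with X hX
        simpa only [Set.mem_iUnion, exists_prop, Set.mem_ofPred_eq] using hX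
      obtain ⟨x, hx, h⟩ := (Ultrafilter.finite_biUnion_mem_iff hVfin).1 h3
      exact ⟨x, hx, h⟩
    obtain ⟨x, hxV, hx⟩ := h2
    obtain ⟨i, hi⟩ := hWL x ⟨hxV.1, hx⟩
    exact (hYinf i).not_finite_diff_inter (hxV.2 i)
      (hi.subset (Set.inter_subset_inter_right _ (hYW i)))
  -- Members of `V` share almost all of each `Y j`, so only their coordinates 0 can be almost
  -- disjoint.
  obtain ⟨Z, hZ, hZV⟩ := exists_avoiding le_rfl (fun _ : Fin 1 => (0 : Fin (m + 1))) hVinf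
    (fun X hX => hF.2.1 X hX.1) (by
      intro X hX X' hX' hne
      obtain ⟨i, hi⟩ := hF.2.2 X hX.1 X' hX'.1 hne
      rcases Fin.eq_zero_or_eq_succ i with rfl | ⟨j, rfl⟩
      · exact ⟨0, hi⟩
      · exact absurd hi ((hYinf j).inter_infinite_of_diff_finite (hX.2 j) (hX'.2 j)))
    ((Cardinal.mk_le_mk_of_subset fun X hX => hX.1).trans_lt hlt1)
  obtain ⟨X, hX, h⟩ := hM (Fin.cons (Z 0) Y) (fun i => by
    refine Fin.cases ?_ (fun i => ?_) i
    · simpa using hZ 0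
    · simpa using hYinf i)
  obtain ⟨i, hi⟩ := hZV X (hVmem X hX fun i => by simpa using h i.succ)
  rw [Subsingleton.elim i 0] at hi
  have h0 := h 0
  rw [Fin.cons_zero] at h0
  exact h0 hi

/-! ### The splitting number -/

theorem exists_isSplittingFamily : ∃ F, IsSplittingFamily F := by
  refine ⟨{A | A.Infinite}, fun A hA => hA, fun X hX => ?_⟩
  let e : ℕ ↪ X := hX.natEmbedding
  have he : Function.Injective fun k => (e k : ℕ) := Subtype.val_injective.comp e.injective
  have h0 : Function.Injective fun k => (e (2 * k) : ℕ) := fun a b h => by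
    have := he h
    omega
  have h1 : Function.Injective fun k => (e (2 * k + 1) : ℕ) := fun a b h => by
    have := he h
    omega
  refine ⟨Set.range fun k => (e (2 * k) : ℕ), Set.infinite_range_of_injective h0, ?_, ?_⟩
  · refine (Set.infinite_range_of_injective h0).mono ?_
    rintro _ ⟨k, rfl⟩
    exact ⟨(e (2 * k)).2, k, rfl⟩
  · refine (Set.infinite_range_of_injective h1).mono ?_
    rintro _ ⟨k, rfl⟩
    refine ⟨(e (2 * k + 1)).2, ?_⟩
    rintro ⟨l, hl⟩
    have := he hl
    omega

/-- Fewer than `𝔰` sets leave some infinite subset of any given infinite set unsplit. -/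
theorem exists_unsplit {S : Set (Set ℕ)} (hS : #S < splittingNumber) {C : Set ℕ}
    (hC : C.Infinite) :
    ∃ Z ⊆ C, Z.Infinite ∧ ∀ A ∈ S, (Z \ A).Finite ∨ (A ∩ Z).Finite := by
  let e : ℕ ↪ C := hC.natEmbedding
  let f : ℕ → ℕ := fun k => e k
  have hf : Function.Injective f := Subtype.val_injective.comp e.injective
  -- Transport to `ℕ` along an enumeration of `C`. Finite preimages are dropped because splitting
  -- families consist of infinite sets; their `A` almost misses the result anyway.
  let T : Set (Set ℕ) := {B ∈ (fun A => f ⁻¹' A) '' S | B.Infinite}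
  have hT : ¬ IsSplittingFamily T := fun h => by
    have h1 : splittingNumber ≤ #T := csInf_le' ⟨T, h, rfl⟩
    have h2 : #T ≤ #S :=
      (Cardinal.mk_le_mk_of_subset fun B hB => hB.1).trans Cardinal.mk_image_le
    exact absurd (h1.trans h2) (not_le.2 hS)
  have hT' : ∃ X : Set ℕ, X.Infinite ∧ ∀ B ∈ T, (X ∩ B).Infinite → (X \ B).Finite := by
    by_contra hcon
    push Not at hcon
    refine hT ⟨fun B hB => hB.2, fun X hX => ?_⟩
    obtain ⟨B, hB, h1, h2⟩ := hcon X hX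
    exact ⟨B, hB, h1, h2⟩
  obtain ⟨X, hX, h⟩ := hT'
  refine ⟨f '' X, ?_, hX.image hf.injOn, fun A hA => ?_⟩
  · rintro _ ⟨k, _, rfl⟩
    exact (e k).2
  · have h1 : A ∩ f '' X = f '' (X ∩ f ⁻¹' A) := by
      rw [Set.image_inter_preimage, Set.inter_comm]
    have h2 : f '' X \ A = f '' (X \ f ⁻¹' A) := by
      ext x
      constructor
      · rintro ⟨⟨k, hk, rfl⟩, hx⟩
        exact ⟨k, ⟨hk, hx⟩, rfl⟩
      · rintro ⟨k, ⟨hk, hx⟩, rfl⟩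
        exact ⟨⟨k, hk, rfl⟩, hx⟩
    rw [h1, h2]
    by_cases hfin : (X ∩ f ⁻¹' A).Finite
    · exact Or.inr (hfin.image f)
    · exact Or.inl ((h _ ⟨⟨A, hA, rfl⟩, fun h => hfin (h.subset Set.inter_subset_right)⟩
        hfin).image f)

theorem min_splittingNumber_le {m : ℕ} (hm : 1 ≤ m) :
    min splittingNumber (nMadNumber m) ≤ nMadNumber (m + 1) := by
  by_contra hcon
  obtain ⟨h1, h2⟩ := lt_min_iff.1 (not_le.1 hcon)
  obtain ⟨F, hF, hM, hc⟩ := exists_mk_eq_nMadNumber (n := m + 1) (by omega)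
  rw [← hc] at h1 h2
  refine false_of_dense_decides hm hF hM h2
    (h2.trans_le ((nMadNumber_le_madNumber hm).trans nMadNumber_one.ge)) fun i C hC => ?_
  obtain ⟨Z, hZC, hZ, h⟩ := exists_unsplit (S := (fun X => X i) '' F)
    (Cardinal.mk_image_le.trans_lt h1) hC
  exact ⟨Z, hZC, hZ, fun X hX => h _ ⟨X, hX, rfl⟩⟩

/-! ### Uncountability of 𝔰, 𝔟 and 𝔞(n), and 𝔟 ≤ 𝔞 -/

theorem exists_pseudoIntersection {S : ℕ → Set ℕ} (hS : Antitone S) (hinf : ∀ k, (S k).Infinite) :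
    ∃ C : Set ℕ, C.Infinite ∧ ∀ k, (C \ S k).Finite := by
  choose c hc hlt using fun k => (hinf k).exists_gt k
  refine ⟨Set.range c, ?_, fun k => ?_⟩
  · exact Set.infinite_of_forall_exists_gt fun a => ⟨c a, ⟨a, rfl⟩, hlt a⟩
  · refine ((Set.finite_Iio k).image c).subset ?_
    rintro _ ⟨⟨j, rfl⟩, hj⟩
    refine ⟨j, ?_, rfl⟩
    by_contra h
    exact hj (hS (not_lt.1 h) (hc j))

theorem aleph_one_le_splittingNumber : Cardinal.aleph 1 ≤ splittingNumber := by
  refine le_csInf (let ⟨F, hF⟩ := exists_isSplittingFamily; ⟨_, F, hF, rfl⟩) ?_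
  rintro _ ⟨F, hF, rfl⟩
  by_contra hlt
  rw [not_le, Cardinal.lt_aleph_one_iff, Cardinal.le_aleph0_iff_set_countable] at hlt
  obtain ⟨A0, hA0, -⟩ := hF.2 Set.univ Set.infinite_univ
  obtain ⟨A, rfl⟩ := hlt.exists_eq_range ⟨A0, hA0⟩
  -- `B k` is whichever of `A k` and its complement the ultrafilter contains; a pseudo-intersection
  -- of the `B k` is split by no `A k`.
  let B : ℕ → Set ℕ := fun k => {x | x ∈ A k ↔ A k ∈ Filter.hyperfilter ℕ}
  have hB : ∀ k, B k ∈ Filter.hyperfilter ℕ := by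
    intro k
    by_cases h : A k ∈ Filter.hyperfilter ℕ
    · have : B k = A k := by ext; simp [B, h]
      rwa [this]
    · have : B k = (A k)ᶜ := by ext; simp [B, h]
      rw [this]
      exact Ultrafilter.compl_mem_iff_notMem.2 h
  obtain ⟨C, hC, h⟩ := exists_pseudoIntersection (S := fun k => ⋂ j ∈ Set.Iic k, B j)
    (fun k l hkl => Set.biInter_subset_biInter_left (Set.Iic_subset_Iic.2 hkl))
    (fun k hfin => Filter.notMem_hyperfilter_of_finite hfin
      ((Filter.biInter_mem (Set.finite_Iic k)).2 fun j _ => hB j))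
  obtain ⟨_, ⟨k, rfl⟩, h1, h2⟩ := hF.2 C hC
  have hk : (C \ B k).Finite := (h k).subset
    (Set.sdiff_subset_sdiff_right (Set.biInter_subset_of_mem (Set.mem_Iic.2 le_rfl)))
  by_cases hA : A k ∈ Filter.hyperfilter ℕ
  · exact h2 (by simpa [B, hA] using hk)
  · exact h1 (hk.subset fun x hx => ⟨hx.1, by simpa [B, hA] using hx.2⟩)

theorem infinite_diff_biUnion {E : ℕ → Set ℕ} (hE : ∀ k, (E k).Infinite)
    (hpair : ∀ k l, k ≠ l → (E k ∩ E l).Finite) (k : ℕ) :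
    (E k \ ⋃ j ∈ Set.Iio k, E j).Infinite := by
  intro h
  refine hE k ((h.union ((Set.finite_Iio k).biUnion fun j hj => hpair k j ?_)).subset ?_)
  · exact (ne_of_lt hj).symm
  · intro x hx
    by_cases h' : x ∈ ⋃ j ∈ Set.Iio k, E j
    · right
      simp only [Set.mem_iUnion] at h' ⊢
      obtain ⟨j, hj, hxj⟩ := h'
      exact ⟨j, hj, hx, hxj⟩
    · exact Or.inl ⟨hx, h'⟩

/-- Given an almost disjoint sequence and fewer than `𝔟` sets almost disjoint from all its members,
some infinite set is almost disjoint from all of them. -/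
theorem exists_almostDisjoint_of_lt_boundingNumber {E : ℕ → Set ℕ} (hE : ∀ k, (E k).Infinite)
    (hpair : ∀ k l, k ≠ l → (E k ∩ E l).Finite) {G : Set (Set ℕ)} (hG : #G < boundingNumber)
    (hGE : ∀ A ∈ G, ∀ k, (A ∩ E k).Finite) :
    ∃ Z : Set ℕ, Z.Infinite ∧ (∀ A ∈ G, (A ∩ Z).Finite) ∧ ∀ k, (E k ∩ Z).Finite := by
  let f : Set ℕ → ℕ → ℕ := fun A k => sSup (A ∩ E k) + 1
  have hbd : ¬ IsUnboundedFamily (f '' G) := fun h =>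
    absurd ((csInf_le' ⟨_, h, rfl⟩ : boundingNumber ≤ _).trans Cardinal.mk_image_le)
      (not_le.2 hG)
  unfold IsUnboundedFamily at hbd
  push Not at hbd
  obtain ⟨g, hg⟩ := hbd
  -- Exceeding `g k` takes `z k` out of `A` for almost all `k`; the summand `k` makes the range
  -- infinite; removing the earlier `E j` leaves `E k` only the points `z j` with `j ≤ k`.
  choose z hz hlt using fun k => (infinite_diff_biUnion hE hpair k).exists_gt (g k + k)
  refine ⟨Set.range z, ?_, fun A hA => ?_, fun k => ?_⟩
  · exact Set.infinite_of_forall_exists_gt fun a => ⟨z a, ⟨a, rfl⟩, by have := hlt a; omega⟩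
  · refine ((hg _ ⟨A, hA, rfl⟩).image z).subset ?_
    rintro _ ⟨hxA, ⟨k, rfl⟩⟩
    refine ⟨k, ?_, rfl⟩
    have h1 : z k ≤ sSup (A ∩ E k) := le_csSup (hGE A hA k).bddAbove ⟨hxA, (hz k).1⟩
    have h2 := hlt k
    simp only [Set.mem_ofPred_eq, f]
    omega
  · refine ((Set.finite_Iic k).image z).subset ?_
    rintro _ ⟨hx, ⟨j, rfl⟩⟩
    refine ⟨j, ?_, rfl⟩
    by_contra h
    exact (hz j).2 (Set.mem_biUnion (Set.mem_Iio.2 (not_le.1 h)) hx)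

/-- Split a countable sequence off a mad family smaller than 𝔟: the other members are almost
disjoint from it, so the previous lemma contradicts maximality. -/
theorem boundingNumber_le_madNumber : boundingNumber ≤ madNumber := by
  refine le_csInf (let ⟨F, hF⟩ := exists_isMadFamily; ⟨_, F, hF, rfl⟩) ?_
  rintro _ ⟨F, hF, rfl⟩
  by_contra hlt
  let E : ℕ ↪ F := hF.1.natEmbedding
  have hne : ∀ k l, k ≠ l → (E k).1 ≠ (E l).1 := fun k l hkl h =>
    hkl (E.injective (Subtype.ext h))
  obtain ⟨Z, hZ, h1, h2⟩ := exists_almostDisjoint_of_lt_boundingNumber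
    (E := fun k => (E k).1) (G := {A ∈ F | ∀ k, A ≠ (E k).1})
    (fun k => hF.2.1 _ (E k).2)
    (fun k l hkl => hF.2.2.1 _ (E k).2 _ (E l).2 (hne k l hkl))
    ((Cardinal.mk_le_mk_of_subset fun A hA => hA.1).trans_lt (not_le.1 hlt))
    (fun A hA k => hF.2.2.1 A hA.1 _ (E k).2 (hA.2 k))
  obtain ⟨A, hA, h⟩ := hF.2.2.2 Z hZ
  rw [Set.inter_comm] at h
  by_cases hAE : ∀ k, A ≠ (E k).1
  · exact h (h1 A ⟨hA, hAE⟩)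
  · push Not at hAE
    obtain ⟨k, rfl⟩ := hAE
    exact h (h2 k)

theorem aleph_one_le_boundingNumber : Cardinal.aleph 1 ≤ boundingNumber := by
  refine le_csInf ⟨_, Set.univ, fun g => ⟨fun m => g m + 1, trivial, ?_⟩, rfl⟩ ?_
  · simpa using Set.infinite_univ
  rintro _ ⟨F, hF, rfl⟩
  by_contra hlt
  rw [not_le, Cardinal.lt_aleph_one_iff, Cardinal.le_aleph0_iff_set_countable] at hlt
  obtain ⟨f0, hf0, -⟩ := hF 0
  obtain ⟨f, rfl⟩ := hlt.exists_eq_range ⟨f0, hf0⟩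
  -- Diagonal bound: the value at `m` is the maximum of the first `m + 1` functions there, so it is
  -- at least `f k m` once `m ≥ k`.
  obtain ⟨_, ⟨k, rfl⟩, h⟩ := hF fun m => (Finset.range (m + 1)).sup fun j => f j m
  refine h ((Set.finite_Iio k).subset fun m hm => ?_)
  by_contra hk
  have h1 : f k m ≤ (Finset.range (m + 1)).sup fun j => f j m :=
    Finset.le_sup (f := fun j => f j m) (Finset.mem_range.2 (by
      rw [Set.mem_Iio] at hk
      omega))
  exact absurd hm (not_lt.2 h1)

theorem aleph_one_le_nMadNumber {n : ℕ} (hn : 1 ≤ n) : Cardinal.aleph 1 ≤ nMadNumber n := by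
  induction n, hn using Nat.le_induction with
  | base =>
    rw [nMadNumber_one]
    exact aleph_one_le_boundingNumber.trans boundingNumber_le_madNumber
  | succ n hn ih =>
    exact (le_min aleph_one_le_splittingNumber ih).trans (min_splittingNumber_le hn)

/-! ### The inequality 𝔟 ≤ 𝔞(2) -/

/-- If `C` has no infinite subset deciding the `i`-th coordinate, then some infinite set is almost
contained in the `i`-th coordinates of infinitely many members. -/
theorem exists_pseudoIntersection_of_not_decides {n : ℕ} {F : Set (Fin n → Set ℕ)} {i : Fin n}
    {C : Set ℕ} (hC : C.Infinite) (hnd : ∀ Z ⊆ C, Z.Infinite → ¬ Decides F i Z) :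
    ∃ (D : Set ℕ) (X : ℕ → Fin n → Set ℕ), D.Infinite ∧ Function.Injective X ∧
      ∀ k, X k ∈ F ∧ (D \ X k i).Finite := by
  have hstep : ∀ Z : {Z : Set ℕ // Z ⊆ C ∧ Z.Infinite}, ∃ X ∈ F,
      (Z.1 \ X i).Infinite ∧ (X i ∩ Z.1).Infinite := by
    intro Z
    have := hnd Z.1 Z.2.1 Z.2.2
    unfold Decides at this
    push Not at this
    exact this
  choose x hxF hxd hxi using hstep
  -- Each stage is split by some member; the next stage is its part inside that member's coordinate.
  let next : {Z : Set ℕ // Z ⊆ C ∧ Z.Infinite} → {Z : Set ℕ // Z ⊆ C ∧ Z.Infinite} :=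
    fun Z => ⟨x Z i ∩ Z.1, Set.inter_subset_right.trans Z.2.1, hxi Z⟩
  let S : ℕ → {Z : Set ℕ // Z ⊆ C ∧ Z.Infinite} := fun k => next^[k] ⟨C, subset_rfl, hC⟩
  have hS : ∀ k, (S (k + 1)).1 = x (S k) i ∩ (S k).1 := fun k => by
    simp only [S, Function.iterate_succ_apply', next]
  have hanti : Antitone fun k => (S k).1 := antitone_nat_of_succ_le fun k => by
    rw [hS]
    exact Set.inter_subset_right
  obtain ⟨D, hD, h⟩ := exists_pseudoIntersection hanti fun k => (S k).2.2
  refine ⟨D, fun k => x (S k), hD, .of_lt_imp_ne fun k l hkl heq => ?_,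
    fun k => ⟨hxF _, (h (k + 1)).subset (Set.sdiff_subset_sdiff_right ?_)⟩⟩
  · have h1 : (S l).1 ⊆ x (S k) i :=
      (hanti (Nat.succ_le_of_lt hkl)).trans ((hS k).le.trans Set.inter_subset_left)
    refine hxd (S l) ?_
    rw [← heq, Set.sdiff_eq_empty.2 h1]
    exact Set.finite_empty
  · exact (hS k).le.trans Set.inter_subset_left

theorem boundingNumber_le_nMadNumber_two : boundingNumber ≤ nMadNumber 2 := by
  by_contra hcon
  obtain ⟨F, hF, hM, hc⟩ := exists_mk_eq_nMadNumber (n := 2) (by omega)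
  have hlt : #F < boundingNumber := hc ▸ not_le.1 hcon
  have hlt1 : #F < nMadNumber 1 :=
    hlt.trans_le (boundingNumber_le_madNumber.trans nMadNumber_one.ge)
  refine false_of_dense_decides le_rfl hF hM hlt1 hlt1 fun i C hC => ?_
  by_contra hnd
  push Not at hnd
  obtain ⟨D, X, hD, hinj, hX⟩ := exists_pseudoIntersection_of_not_decides hC hnd
  obtain ⟨j, hji, hj⟩ : ∃ j : Fin 2, j ≠ i ∧ ∀ t, t ≠ i → t = j := by
    fin_cases i
    · exact ⟨1, by decide, by decide⟩
    · exact ⟨0, by decide, by decide⟩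
  -- `D` is almost contained in `X k i`, so a `Y` meeting `D` infinitely also meets `X k i`
  -- infinitely, and must be almost disjoint from `X k` in the other coordinate `j`.
  have hpair : ∀ Y ∈ F, (Y i ∩ D).Infinite → ∀ k, Y ≠ X k → (Y j ∩ X k j).Finite := by
    intro Y hY hYD k hne
    obtain ⟨t, ht⟩ := hF.2.2 Y hY _ (hX k).1 hne
    by_cases hti : t = i
    · subst hti
      refine absurd (((hX k).2.union ht).subset ?_) hYD
      rintro x ⟨hxY, hxD⟩
      by_cases hxk : x ∈ X k t
      · exact Or.inr ⟨hxY, hxk⟩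
      · exact Or.inl ⟨hxD, hxk⟩
    · rwa [← hj t hti]
  have hXD : ∀ k, (X k i ∩ D).Infinite := fun k h => hD.not_finite_diff_inter (hX k).2 h
  obtain ⟨Z, hZ, h1, h2⟩ := exists_almostDisjoint_of_lt_boundingNumber
    (E := fun k => X k j)
    (G := (fun Y => Y j) '' {Y ∈ F | (Y i ∩ D).Infinite ∧ ∀ k, Y ≠ X k})
    (fun k => hF.2.1 _ (hX k).1 j)
    (fun k l hkl => hpair _ (hX k).1 (hXD k) l fun h => hkl (hinj h))
    ((Cardinal.mk_image_le.trans (Cardinal.mk_le_mk_of_subset fun A hA => hA.1)).trans_lt hlt)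
    (by
      rintro _ ⟨Y, hY, rfl⟩ k
      exact hpair Y hY.1 hY.2.1 k (hY.2.2 k))
  -- Put `D` in coordinate `i` and `Z` in coordinate `j`: a member meeting both is one of the `X k`
  -- or has its coordinate `j` in `G`, and `Z` is almost disjoint from either.
  obtain ⟨Y, hY, h⟩ := hM (fun t => if t = i then D else Z) (fun t => by
    split_ifs
    · exact hD
    · exact hZ)
  have hYi : (Y i ∩ D).Infinite := by simpa using h i
  have hYj : (Y j ∩ Z).Infinite := by simpa [hji] using h j
  by_cases hYX : ∀ k, Y ≠ X k
  · exact hYj (h1 _ ⟨Y, ⟨hY, hYi, hYX⟩, rfl⟩)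
  · push Not at hYX
    obtain ⟨k, rfl⟩ := hYX
    exact hYj (h2 k)

theorem mainTheorem3 :
    (∀ n : ℕ, 1 ≤ n →
      Cardinal.aleph 1 ≤ nMadNumber (n + 1) ∧
      nMadNumber (n + 1) ≤ nMadNumber n ∧
      nMadNumber n ≤ madNumber) ∧
    (∀ n : ℕ, 2 ≤ n → min splittingNumber (nMadNumber (n - 1)) ≤ nMadNumber n) ∧
    boundingNumber ≤ nMadNumber 2 := by
  refine ⟨fun n hn => ⟨aleph_one_le_nMadNumber (by omega), nMadNumber_succ_le hn,
    nMadNumber_le_madNumber hn⟩, fun n hn => ?_, boundingNumber_le_nMadNumber_two⟩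
  obtain ⟨m, rfl⟩ := Nat.exists_eq_add_of_le' (show 1 ≤ n by omega)
  exact min_splittingNumber_le (by omega)
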